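/- For a finite simple graph $G$, let $AC(G,x)=\sum_{i\ge 0} a_i x^i$, where $a_i$ is the number of vertex subsets $S\subseteq V(G)$ with $|S|=i$ such that the induced subgraph $G[S]$ is acyclic. For graphs $G,H$, let $G[H]$ denote the lexicographic product: each vertex of $G$ is replaced by a copy of $H$, with all edges between two distinct copies exactly when the corresponding vertices of $G$ are adjacent. Let $K_{1,n-1}$ be the star with $n$ vertices and $K_2$ the complete graph on two vertices. Then there is $n_0$ such that for all $n\ge n_0$ the polynomial $AC(K_{1,n-1}[K_2],x)$ has a complex root with positive real part. Moreover, for every $\varepsilon>0$ there is $n_0(\varepsilon)$ such that for all $n\ge n_0(\varepsilon)$ the polynomial $AC(K_{1,n-1}[K_2],x)$ has a complex root $z$ with $\operatorname{Re} z>0$ and $\left|\operatorname{Re} z-\frac{\sqrt2-1}{2}\right|<\varepsilon$. -/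

import Mathlib

open Polynomial

/-- The lexicographic product `G[H]`: every vertex of `G` is replaced by a copy of `H`, and two
distinct copies of `H` are completely joined exactly when the corresponding vertices of `G` are
adjacent. -/
def SimpleGraph.lexProduct {V W : Type*} (G : SimpleGraph V) (H : SimpleGraph W) :
    SimpleGraph (V × W) where
  Adj p q := G.Adj p.1 q.1 ∨ (p.1 = q.1 ∧ H.Adj p.2 q.2)
  symm.symm p q h := by
    rcases h with h | ⟨h1, h2⟩
    · exact Or.inl h.symm
    · exact Or.inr ⟨h1.symm, h2.symm⟩
  loopless.irrefl p h := by
    rcases h with h | ⟨_, h⟩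
    · exact G.irrefl h
    · exact H.irrefl h

/-- The number `a_i` of vertex sets of cardinality `i` that induce an acyclic subgraph of `G`. -/
noncomputable def SimpleGraph.acyclicCount {V : Type*} [Fintype V] (G : SimpleGraph V)
    (i : ℕ) : ℕ :=
  Nat.card {S : Finset V // S.card = i ∧ (G.induce (S : Set V)).IsAcyclic}

/-- The acyclic polynomial `AC(G, x) = ∑ a_i x^i` of a finite graph `G`. The sum stops at the
order of `G` since there are no larger vertex sets. -/
noncomputable def SimpleGraph.acyclicPoly {V : Type*} [Fintype V] (G : SimpleGraph V) : ℤ[X] :=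
  ∑ i ∈ Finset.range (Fintype.card V + 1), C (G.acyclicCount i : ℤ) * X ^ i

/-- The graph `K_{1,n-1}[K_2]` (meaningful for `n ≥ 1`). -/
def starLexK2 (n : ℕ) : SimpleGraph ((Fin 1 ⊕ Fin (n - 1)) × Fin 2) :=
  (completeBipartiteGraph (Fin 1) (Fin (n - 1))).lexProduct (SimpleGraph.completeGraph (Fin 2))

/-!
With `m = n - 1`, sorting the acyclic vertex sets of `K_{1,m}[K₂]` by their intersection with the
central copy of `K₂` gives the acyclic polynomial `(1 + x)^{2m} + 2x (1 + 2x)^m + x²`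
(`aeval_acyclicPoly_starLexK2`).

As `m` grows, the zeros of this polynomial accumulate at every point `x₀ ≠ 0` where the first two
terms have the same exponential rate of growth, `|1 + x₀|² = |1 + 2x₀|`, and dominate the third,
`|1 + 2x₀| > 1` (`eventually_exists_zero_near`, an instance of the Beraha–Kahane–Weiss phenomenon).
Indeed, near such a point there is a holomorphic solution `x = X(w)` of
`(1 + x)² = e^w (1 + 2x)` (`exists_local_solution`). Setting `w = (2πik + v) / m`, with `k` such
that `w` is close to the purely imaginary parameter of `x₀`, and dividing by `(1 + 2x)^m`, turns the
polynomial equation into `e^v + 2X(w) + X(w)² / (1 + 2X(w))^m = 0`. On a fixed disc of values of `v`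
the left side converges uniformly to `e^v + 2x₀`, which vanishes at `v₀ = log (-2x₀)` and is bounded
below on the circle `|v - v₀| = 1/2`. The maximum principle for the inverse then yields a zero in
the disc (`DiffContOnCl.exists_zero_of_norm_center_lt`).

It remains to observe that the curve contains a point with real part `(√2 - 1) / 2 > 0`
(`exists_mem_curve_re_eq`).
-/

open Filter Topology

/-! ### The acyclic polynomial of `K_{1,n-1}[K₂]` -/

open scoped Classical in
theorem SimpleGraph.aeval_acyclicPoly {V : Type*} [Fintype V] (G : SimpleGraph V) (z : ℂ) :
    aeval z G.acyclicPoly =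
      ∑ S : Finset V, if (G.induce (S : Set V)).IsAcyclic then z ^ S.card else 0 := by
  have hmaps : ∀ S ∈ (Finset.univ : Finset (Finset V)),
      S.card ∈ Finset.range (Fintype.card V + 1) := fun S _ =>
    Finset.mem_range.2 (Nat.lt_succ_of_le S.card_le_univ)
  rw [← Finset.sum_fiberwise_of_maps_to hmaps, SimpleGraph.acyclicPoly, map_sum]
  refine Finset.sum_congr rfl fun i _ => ?_
  rw [← Finset.sum_filter, Finset.filter_filter,
    Finset.sum_congr rfl (g := fun _ => z ^ i) (fun S hS => by simp_all), Finset.sum_const]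
  simp [SimpleGraph.acyclicCount, Nat.card_eq_fintype_card, Fintype.card_subtype]

/-- A graph in which every vertex, with at most one exception, has at most one neighbour has no
cycle: every cycle passes through a non-exceptional vertex, which has two neighbours on it. -/
theorem SimpleGraph.isAcyclic_of_forall_notMem_subsingleton_neighborSet {V : Type*}
    {G : SimpleGraph V} {s : Set V} (hs : s.Subsingleton)
    (h : ∀ v, v ∉ s → (G.neighborSet v).Subsingleton) : G.IsAcyclic := by
  have key : ∀ v, v ∉ s → ∀ p : G.Walk v v, ¬ p.IsCycle := fun v hv p hp =>
    hp.snd_ne_penultimate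
      (h v hv (p.adj_snd hp.not_nil) (p.adj_penultimate hp.not_nil).symm)
  classical
  intro v p hp
  by_cases hv : v ∈ s
  · have hadj := p.adj_snd hp.not_nil
    exact key p.snd (fun h' => hadj.ne (hs hv h')) _ (hp.rotate (u := p.snd) (by simp))
  · exact key v hv p hp

/-- A vertex set of a graph on `V × W` is the same as a family of subsets of `W` indexed by `V`;
this is that bijection for `V = Fin 1 ⊕ Fin m`, with the first member of the family split off. -/
def finsetStarProdEquiv (m : ℕ) (W : Type*) [Fintype W] [DecidableEq W] :
    Finset W × (Fin m → Finset W) ≃ Finset ((Fin 1 ⊕ Fin m) × W) where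
  toFun p := Finset.univ.filter fun q => q.2 ∈ Sum.elim (fun _ => p.1) p.2 q.1
  invFun S := (Finset.univ.filter fun j => (Sum.inl 0, j) ∈ S,
    fun i => Finset.univ.filter fun j => (Sum.inr i, j) ∈ S)
  left_inv p := by ext <;> simp
  right_inv S := by
    ext ⟨v | v, j⟩
    · simp [Fin.fin_one_eq_zero v]
    · simp

theorem card_finsetStarProdEquiv (m : ℕ) {W : Type*} [Fintype W] [DecidableEq W]
    (c : Finset W) (f : Fin m → Finset W) :
    (finsetStarProdEquiv m W (c, f)).card = c.card + ∑ i, (f i).card := by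
  have h : ∀ t : Finset W, ∑ j, (if j ∈ t then 1 else 0) = t.card := by simp
  simp only [finsetStarProdEquiv, Equiv.coe_fn_mk, Finset.card_filter, Fintype.sum_prod_type,
    Fintype.sum_sum_type, Sum.elim_inl, Sum.elim_inr, h]
  simp

theorem starLexK2_adj_iff {n : ℕ} (p q : (Fin 1 ⊕ Fin (n - 1)) × Fin 2) :
    (starLexK2 n).Adj p q ↔
      (p.1.isLeft ∧ q.1.isRight ∨ p.1.isRight ∧ q.1.isLeft) ∨ p.1 = q.1 ∧ p.2 ≠ q.2 := by
  simp [starLexK2, SimpleGraph.lexProduct]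

/-- A vertex set of `K_{1,n-1}[K₂]` induces an acyclic graph iff it avoids the central copy of
`K₂`, or it has one central vertex and at most one vertex in every other copy, or it is the whole
central copy. -/
theorem isAcyclic_induce_starLexK2_iff {n : ℕ} (c : Finset (Fin 2))
    (f : Fin (n - 1) → Finset (Fin 2)) :
    ((starLexK2 n).induce
        (finsetStarProdEquiv (n - 1) (Fin 2) (c, f) :
          Set ((Fin 1 ⊕ Fin (n - 1)) × Fin 2))).IsAcyclic ↔
      c.card = 0 ∨ (c.card = 1 ∧ ∀ i, (f i).card ≤ 1) ∨ (c.card = 2 ∧ ∀ i, (f i).card = 0) := by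
  have hl : ∀ v j, (Sum.inl v, j) ∈ finsetStarProdEquiv (n - 1) (Fin 2) (c, f) ↔ j ∈ c := by
    simp [finsetStarProdEquiv]
  have hr : ∀ i j, (Sum.inr i, j) ∈ finsetStarProdEquiv (n - 1) (Fin 2) (c, f) ↔ j ∈ f i := by
    simp [finsetStarProdEquiv]
  generalize finsetStarProdEquiv (n - 1) (Fin 2) (c, f) = S at hl hr ⊢
  -- Inside a single copy of `K₂` a vertex has only one neighbour.
  have htwo : ∀ a b d : Fin 2, a ≠ b → a ≠ d → b = d := by decide
  constructor
  · intro h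
    have htri : ∀ p q r, p ∈ S → q ∈ S → r ∈ S → (starLexK2 n).Adj p q →
        (starLexK2 n).Adj p r → (starLexK2 n).Adj q r → False := by
      intro p q r hp hq hr hpq hpr hqr
      refine h.cliqueFree le_rfl {⟨p, hp⟩, ⟨q, hq⟩, ⟨r, hr⟩}
        (SimpleGraph.is3Clique_triple_iff.2 ⟨?_, ?_, ?_⟩) <;> simpa
    -- Each excluded configuration contains a triangle through the central copy.
    have hc : c.card ≤ 2 := by simpa using c.card_le_univ
    interval_cases hcard : c.card
    · simp
    · refine Or.inr (Or.inl ⟨rfl, fun i => ?_⟩)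
      by_contra! hi
      obtain ⟨a, ha, b, hb, hab⟩ := Finset.one_lt_card.1 hi
      obtain ⟨x, hx⟩ := Finset.card_pos.1 (hcard ▸ one_pos)
      refine htri (Sum.inl 0, x) (Sum.inr i, a) (Sum.inr i, b) ((hl _ _).2 hx) ((hr _ _).2 ha)
        ((hr _ _).2 hb) ?_ ?_ ?_ <;> simp [starLexK2_adj_iff, hab]
    · refine Or.inr (Or.inr ⟨rfl, fun i => ?_⟩)
      by_contra hi
      obtain ⟨a, ha⟩ := Finset.card_pos.1 (Nat.pos_of_ne_zero hi)
      obtain ⟨x, hx, y, hy, hxy⟩ := Finset.one_lt_card.1 (hcard ▸ one_lt_two)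
      refine htri (Sum.inl 0, x) (Sum.inl 0, y) (Sum.inr i, a) ((hl _ _).2 hx) ((hl _ _).2 hy)
        ((hr _ _).2 ha) ?_ ?_ ?_ <;> simp [starLexK2_adj_iff, hxy]
  · have hac : ∀ s : Set ((Fin 1 ⊕ Fin (n - 1)) × Fin 2),
        (∀ p ∈ S, ∀ q ∈ S, p ∈ s → q ∈ s → p = q) →
        (∀ p ∈ S, ∀ q ∈ S, ∀ r ∈ S, p ∉ s → (starLexK2 n).Adj p q → (starLexK2 n).Adj p r →
          q = r) → ((starLexK2 n).induce (S : Set _)).IsAcyclic := fun s h1 h2 =>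
      SimpleGraph.isAcyclic_of_forall_notMem_subsingleton_neighborSet
        (s := {p : (S : Set ((Fin 1 ⊕ Fin (n - 1)) × Fin 2)) | p.1 ∈ s})
        (fun p hp q hq => Subtype.ext (h1 p p.2 q q.2 hp hq))
        (fun p hp q hq r hr => Subtype.ext (h2 p p.2 q q.2 r r.2 hp hq hr))
    -- Only in the second case is there an exceptional vertex, the central one.
    simp only [starLexK2_adj_iff] at hac
    rintro (h | ⟨h, hf⟩ | ⟨h, hf⟩)
    · rw [Finset.card_eq_zero] at h
      subst h
      refine hac ∅ (by simp) ?_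
      rintro ⟨v | i, a⟩ hp ⟨v' | i', b⟩ hq ⟨v'' | i'', d⟩ hr' - h1 h2 <;>
        simp only [hl, hr, Finset.notMem_empty] at hp hq hr'
      simp at h1 h2
      simp [← h1.1, ← h2.1, htwo a b d h1.2 h2.2]
    · refine hac {p | p.1.isLeft} ?_ ?_
      · rintro ⟨v | i, a⟩ hp ⟨v' | i', b⟩ hq hp' hq'
        · rw [Subsingleton.elim v v', Finset.card_le_one.1 h.le a ((hl _ _).1 hp) b ((hl _ _).1 hq)]
        all_goals simp at hp' hq'
      · have hne : ∀ i i' a b, (Sum.inr i, a) ∈ S → (Sum.inr i', b) ∈ S → i = i' → a = b := by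
          rintro i _ a b ha hb rfl
          exact Finset.card_le_one.1 (hf i) a ((hr _ _).1 ha) b ((hr _ _).1 hb)
        rintro ⟨v | i, a⟩ hp ⟨v' | i', b⟩ hq ⟨v'' | i'', d⟩ hr' hs h1 h2
        any_goals exact absurd rfl hs
        · rw [Subsingleton.elim v' v'',
            Finset.card_le_one.1 h.le b ((hl _ _).1 hq) d ((hl _ _).1 hr')]
        · simp at h2
          exact absurd (hne _ _ _ _ hp hr' h2.1) h2.2
        all_goals
          simp at h1
          exact absurd (hne _ _ _ _ hp hq h1.1) h1.2
    · have hf' : ∀ i, f i = ∅ := fun i => Finset.card_eq_zero.1 (hf i)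
      refine hac ∅ (by simp) ?_
      rintro ⟨v | i, a⟩ hp ⟨v' | i', b⟩ hq ⟨v'' | i'', d⟩ hr' - h1 h2 <;>
        simp only [hl, hr, hf', Finset.notMem_empty] at hp hq hr'
      simp at h1 h2
      rw [Subsingleton.elim v' v'', htwo a b d h1.2 h2.2]

/-- If the parts of a vertex set in the copies of `K₂` may be chosen independently, its generating
function is a power of the generating function of a single copy. -/
theorem sum_pi_finset_pow_card (m : ℕ) (P : Finset (Fin 2) → Prop) [DecidablePred P] (z : ℂ) :
    (∑ f : Fin m → Finset (Fin 2), if ∀ i, P (f i) then z ^ ∑ i, (f i).card else 0) =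
      (∑ t : Finset (Fin 2), if P t then z ^ t.card else 0) ^ m := by
  rw [← Fin.prod_const, Finset.prod_univ_sum, Fintype.piFinset_univ]
  refine Finset.sum_congr rfl fun f _ => ?_
  rw [Finset.prod_ite_zero, Finset.prod_pow_eq_pow_sum]
  simp

theorem aeval_acyclicPoly_starLexK2 (n : ℕ) (z : ℂ) :
    aeval z (starLexK2 n).acyclicPoly =
      ((1 + z) ^ 2) ^ (n - 1) + 2 * z * (1 + 2 * z) ^ (n - 1) + z ^ 2 := by
  classical
  rw [SimpleGraph.aeval_acyclicPoly]
  have := Equiv.sum_comp (finsetStarProdEquiv (n - 1) (Fin 2)) fun S =>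
    if ((starLexK2 n).induce (S : Set ((Fin 1 ⊕ Fin (n - 1)) × Fin 2))).IsAcyclic then z ^ S.card else 0
  refine this.symm.trans ?_
  rw [Fintype.sum_prod_type]
  simp only [isAcyclic_induce_starLexK2_iff, card_finsetStarProdEquiv]
  have hsum : ∀ g : Finset (Fin 2) → ℂ, ∑ t, g t = g ∅ + (g {0} + (g {1} + g {0, 1})) := by
    intro g
    rw [show (Finset.univ : Finset (Finset (Fin 2))) = {∅, {0}, {1}, {0, 1}} by decide,
      Finset.sum_insert (by decide), Finset.sum_insert (by decide), Finset.sum_insert (by decide),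
      Finset.sum_singleton]
  have h0 := sum_pi_finset_pow_card (n - 1) (fun _ => True) z
  have h1 := sum_pi_finset_pow_card (n - 1) (fun t => t.card ≤ 1) z
  have h2 := sum_pi_finset_pow_card (n - 1) (fun t => t.card = 0) z
  have t0 : (∑ t : Finset (Fin 2), if True then z ^ t.card else 0) = (1 + z) ^ 2 := by
    rw [hsum]
    simp
    ring
  have t1 : (∑ t : Finset (Fin 2), if t.card ≤ 1 then z ^ t.card else 0) = 1 + 2 * z := by
    rw [hsum]
    simp
    ring
  have t2 : (∑ t : Finset (Fin 2), if t.card = 0 then z ^ t.card else 0) = 1 := by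
    rw [hsum]
    simp
  rw [t0] at h0
  rw [t1] at h1
  rw [t2, one_pow] at h2
  rw [hsum, ← h0, ← h1]
  -- The term `z²` is also written as a sum over `f`, with `f = ∅` the only contribution.
  have h2' : z ^ 2 = z ^ 2 * ∑ f : Fin (n - 1) → Finset (Fin 2),
    if ∀ i, (f i).card = 0 then z ^ ∑ i, (f i).card else 0 := by rw [h2, mul_one]
  rw [h2', Finset.mul_sum, Finset.mul_sum]
  simp only [← Finset.sum_add_distrib]
  refine Finset.sum_congr rfl fun f _ => ?_
  simp only [Finset.card_empty, Finset.card_singleton, Finset.card_pair (zero_ne_one (α := Fin 2))]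
  simp
  split_ifs <;> ring

/-! ### Zeros near the equimodular curve -/

/-- A function that is smaller at the centre of a disc than anywhere on its boundary has a zero in
the disc, by the maximum principle for its inverse. -/
theorem DiffContOnCl.exists_zero_of_norm_center_lt {f : ℂ → ℂ} {z₀ : ℂ} {r δ : ℝ} (hr : 0 < r)
    (hf : DiffContOnCl ℂ f (Metric.ball z₀ r)) (hδ : ∀ z ∈ Metric.sphere z₀ r, δ ≤ ‖f z‖)
    (h₀ : ‖f z₀‖ < δ) : ∃ z ∈ Metric.closedBall z₀ r, f z = 0 := by
  by_contra! hne
  have hδ0 : 0 < δ := (norm_nonneg _).trans_lt h₀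
  have hcl : closure (Metric.ball z₀ r) = Metric.closedBall z₀ r := closure_ball z₀ hr.ne'
  have hinv : DiffContOnCl ℂ f⁻¹ (Metric.ball z₀ r) := hf.inv fun z hz => hne z (hcl ▸ hz)
  have hle := Complex.norm_le_of_forall_mem_frontier_norm_le Metric.isBounded_ball hinv
    (C := δ⁻¹) (fun z hz => by
      rw [frontier_ball z₀ hr.ne'] at hz
      simpa using inv_anti₀ hδ0 (hδ z hz)) (subset_closure (Metric.mem_ball_self hr))
  have hpos : 0 < ‖f z₀‖ := norm_pos_iff.2 (hne z₀ (Metric.mem_closedBall_self hr.le))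
  rw [Pi.inv_apply, norm_inv, inv_le_inv₀ hpos hδ0] at hle
  exact hle.not_gt h₀

theorem norm_exp_sub_exp_ge {v v₀ : ℂ} (h : ‖v - v₀‖ = 1 / 2) :
    ‖Complex.exp v₀‖ / 4 ≤ ‖Complex.exp v - Complex.exp v₀‖ := by
  have h1 := Complex.norm_exp_sub_one_sub_id_le (x := v - v₀) (by rw [h]; norm_num)
  have h2 : ‖v - v₀‖ ≤ ‖Complex.exp (v - v₀) - 1‖ + ‖Complex.exp (v - v₀) - 1 - (v - v₀)‖ := by
    have := norm_sub_le (Complex.exp (v - v₀) - 1) (Complex.exp (v - v₀) - 1 - (v - v₀))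
    simpa using this
  have h3 : Complex.exp v - Complex.exp v₀ =
      Complex.exp v₀ * (Complex.exp (v - v₀) - 1) := by
    rw [mul_sub, ← Complex.exp_add]
    simp
  rw [h] at h1 h2
  rw [h3, norm_mul]
  nlinarith [norm_nonneg (Complex.exp v₀)]

/-- Near a point `x₀` with `(1 + x₀)² = e^{w₀} (1 + 2 x₀)`, this equation is solved by a
holomorphic function of `w`: the equation is quadratic in the unknown, and its discriminant
`4 (e^{2w} - e^w)` does not vanish at `w₀` because `x₀ ≠ 0`. -/
theorem exists_local_solution {x₀ w₀ : ℂ} (hx₀ : x₀ ≠ 0)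
    (hw₀ : (1 + x₀) ^ 2 = Complex.exp w₀ * (1 + 2 * x₀)) :
    ∃ X : ℂ → ℂ, X w₀ = x₀ ∧ (∀ᶠ w in 𝓝 w₀, DifferentiableAt ℂ X w) ∧
      ∀ w, (1 + X w) ^ 2 = Complex.exp w * (1 + 2 * X w) := by
  set q₀ := Complex.exp w₀ with hq₀
  have hne0 : q₀ ≠ 0 := Complex.exp_ne_zero _
  have hne1 : q₀ ≠ 1 := by
    intro h
    rw [h] at hw₀
    exact hx₀ (pow_eq_zero_iff two_ne_zero |>.1 (by linear_combination hw₀))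
  have hD : q₀ ^ 2 - q₀ ≠ 0 := by
    rw [show q₀ ^ 2 - q₀ = q₀ * (q₀ - 1) by ring]
    exact mul_ne_zero hne0 (sub_ne_zero.2 hne1)
  -- The square root of the discriminant, normalised to take the right value at `w₀`.
  let D : ℂ → ℂ := fun w => (Complex.exp w ^ 2 - Complex.exp w) / (q₀ ^ 2 - q₀)
  have hDdiff : Differentiable ℂ D := by fun_prop
  have hD0 : D w₀ = 1 := div_self hD
  refine ⟨fun w => Complex.exp w - 1 + (x₀ + 1 - q₀) * D w ^ (1 / 2 : ℂ), ?_, ?_, fun w => ?_⟩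
  · simp [hD0, ← hq₀]
  · have hs : ∀ᶠ w in 𝓝 w₀, D w ∈ Complex.slitPlane :=
      hDdiff.continuous.continuousAt.eventually_mem
        (Complex.isOpen_slitPlane.mem_nhds (by simp [hD0]))
    filter_upwards [hs] with w hw
    have := (hDdiff w).cpow_const (c := (1 / 2 : ℂ)) hw
    fun_prop
  · have hsq : (D w ^ (1 / 2 : ℂ)) ^ 2 = D w := by
      rw [← Complex.cpow_nat_mul]
      norm_num
    have hc : (x₀ + 1 - q₀) ^ 2 = q₀ ^ 2 - q₀ := by linear_combination hw₀
    have hp : (x₀ + 1 - q₀) ^ 2 * (D w ^ (1 / 2 : ℂ)) ^ 2 =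
        Complex.exp w ^ 2 - Complex.exp w := by
      rw [hsq, hc]
      exact mul_div_cancel₀ _ hD
    linear_combination hp

/-- Every point `x₀ ≠ 0` of the curve `|1 + x|² = |1 + 2x|` outside the closed disc of radius
`1 / 2` around `-1 / 2` is a limit of zeros of `(1 + x)^{2m} + 2x (1 + 2x)^m + x²`. -/
theorem eventually_exists_zero_near {x₀ : ℂ} (hx₀ : x₀ ≠ 0)
    (hcurve : ‖(1 + x₀) ^ 2‖ = ‖1 + 2 * x₀‖) (hgt : 1 < ‖1 + 2 * x₀‖) {ε : ℝ} (hε : 0 < ε) :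
    ∀ᶠ m : ℕ in atTop, ∃ z : ℂ, ‖z - x₀‖ < ε ∧
      ((1 + z) ^ 2) ^ m + 2 * z * (1 + 2 * z) ^ m + z ^ 2 = 0 := by
  have h1 : 1 + 2 * x₀ ≠ 0 := norm_pos_iff.1 (one_pos.trans hgt)
  set q₀ := (1 + x₀) ^ 2 / (1 + 2 * x₀) with hq₀
  have hq₀n : ‖q₀‖ = 1 := by rw [hq₀, norm_div, hcurve, div_self (by positivity)]
  set θ := q₀.arg with hθ
  have hexp : Complex.exp (θ * Complex.I) = q₀ := by
    have := Complex.norm_mul_exp_arg_mul_I q₀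
    rwa [hq₀n, Complex.ofReal_one, one_mul] at this
  obtain ⟨X, hX0, hXd, hXeq⟩ := exists_local_solution hx₀ (w₀ := θ * Complex.I)
    (by rw [hexp, hq₀, div_mul_cancel₀ _ h1])
  have hXc : Tendsto X (𝓝 (θ * Complex.I)) (𝓝 x₀) := by
    have := hXd.self_of_nhds.continuousAt.tendsto
    rwa [hX0] at this
  obtain ⟨ρ, hρ1, hρ⟩ := exists_between hgt
  have hn0 : 0 < ‖x₀‖ := norm_pos_iff.2 hx₀
  have hev : ∀ᶠ w in 𝓝 (θ * Complex.I), DifferentiableAt ℂ X w ∧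
      ‖X w - x₀‖ < min ε (‖x₀‖ / 16) ∧ ρ < ‖1 + 2 * X w‖ := by
    refine hXd.and (.and ?_ ?_)
    · have := hXc.sub_const x₀ |>.norm
      rw [sub_self, norm_zero] at this
      exact this.eventually_lt_const (lt_min hε (by positivity))
    · exact ((hXc.const_mul 2).const_add 1).norm.eventually_const_lt hρ
  obtain ⟨η, hη, hball⟩ := Metric.eventually_nhds_iff.1 hev
  set v₀ := Complex.log (-(2 * x₀)) with hv₀
  have hev₀ : Complex.exp v₀ = -(2 * x₀) := Complex.exp_log (by simpa using hx₀)
  have hlim1 : ∀ᶠ m : ℕ in atTop, (2 * Real.pi + ‖v₀‖ + 1) / m < η :=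
    (tendsto_const_div_atTop_nhds_zero_nat _).eventually_lt_const hη
  have hlim2 : ∀ᶠ m : ℕ in atTop, (2 * ‖x₀‖) ^ 2 * (ρ⁻¹) ^ m < ‖x₀‖ / 8 := by
    have := (tendsto_pow_atTop_nhds_zero_of_lt_one (r := ρ⁻¹) (by positivity)
      (inv_lt_one_of_one_lt₀ hρ1)).const_mul ((2 * ‖x₀‖) ^ 2)
    rw [mul_zero] at this
    exact this.eventually_lt_const (by positivity)
  filter_upwards [hlim1, hlim2, eventually_gt_atTop 0] with m hm1 hm2 hm0
  have hm0' : (0 : ℝ) < m := by exact_mod_cast hm0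
  have hmC : (m : ℂ) ≠ 0 := by exact_mod_cast hm0.ne'
  -- The angle `θ` is approximated by a multiple of `2π / m`, so that `e^{m W(v)} = e^v`.
  set k : ℤ := ⌊m * θ / (2 * Real.pi)⌋ with hk
  let W : ℂ → ℂ := fun v => (k * (2 * Real.pi * Complex.I) + v) / m
  have hWexp : ∀ v, Complex.exp (W v) ^ m = Complex.exp v := fun v => by
    rw [← Complex.exp_nat_mul, mul_div_cancel₀ _ hmC, add_comm, Complex.exp_periodic.int_mul k]
  have hWdist : ∀ v ∈ Metric.closedBall v₀ (1 / 2), dist (W v) (θ * Complex.I) < η := by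
    intro v hv
    have hv' : ‖v‖ ≤ ‖v₀‖ + 1 / 2 := by
      have := norm_le_norm_add_norm_sub' v v₀
      rw [Metric.mem_closedBall, dist_eq_norm] at hv
      linarith
    have hfl := Int.floor_le (m * θ / (2 * Real.pi))
    have hfl' := Int.lt_floor_add_one (m * θ / (2 * Real.pi))
    rw [← hk, le_div_iff₀ Real.two_pi_pos] at hfl
    rw [← hk, div_lt_iff₀ Real.two_pi_pos] at hfl'
    have hkr : ‖(k * (2 * Real.pi) - m * θ : ℝ)‖ ≤ 2 * Real.pi := by
      rw [Real.norm_eq_abs, abs_le]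
      constructor <;> nlinarith
    have hW : W v - θ * Complex.I =
        (((k * (2 * Real.pi) - m * θ : ℝ) : ℂ) * Complex.I + v) / m := by
      simp only [W]
      push_cast
      field_simp
      ring
    rw [dist_eq_norm, hW, norm_div, Complex.norm_natCast]
    refine lt_of_le_of_lt ?_ hm1
    gcongr
    refine (norm_add_le _ _).trans ?_
    rw [norm_mul, Complex.norm_I, mul_one, Complex.norm_real]
    linarith
  have hWd : Differentiable ℂ W := by
    intro v
    simp only [W]
    fun_prop
  let f : ℂ → ℂ := fun v =>
    Complex.exp v + 2 * X (W v) + X (W v) ^ 2 / (1 + 2 * X (W v)) ^ m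
  have hne : ∀ v ∈ Metric.closedBall v₀ (1 / 2), 1 + 2 * X (W v) ≠ 0 := fun v hv =>
    norm_pos_iff.1 (by linarith [(hball (hWdist v hv)).2.2])
  have hfd : DifferentiableOn ℂ f (Metric.closedBall v₀ (1 / 2)) := by
    intro v hv
    have hX : DifferentiableAt ℂ (fun v => X (W v)) v :=
      (hball (hWdist v hv)).1.comp v (hWd v)
    have hpow : (1 + 2 * X (W v)) ^ m ≠ 0 := pow_ne_zero _ (hne v hv)
    refine DifferentiableAt.differentiableWithinAt ?_
    exact (Complex.differentiableAt_exp.add (hX.const_mul 2)).add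
      ((hX.pow 2).div (((hX.const_mul 2).const_add 1).pow m) hpow)
  have hclose : ∀ v ∈ Metric.closedBall v₀ (1 / 2),
      ‖f v - (Complex.exp v - Complex.exp v₀)‖ < ‖x₀‖ / 4 := by
    intro v hv
    obtain ⟨-, hb1, hb2⟩ := hball (hWdist v hv)
    have hb3 := hb1.trans_le (min_le_right _ _)
    have hXn : ‖X (W v)‖ ≤ 2 * ‖x₀‖ := by
      have := norm_le_norm_add_norm_sub' (X (W v)) x₀
      linarith
    have hdecay : ‖X (W v) ^ 2 / (1 + 2 * X (W v)) ^ m‖ ≤ (2 * ‖x₀‖) ^ 2 * (ρ⁻¹) ^ m := by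
      rw [norm_div, norm_pow, norm_pow, inv_pow, ← div_eq_mul_inv]
      gcongr
    have he : f v - (Complex.exp v - Complex.exp v₀) =
        2 * (X (W v) - x₀) + X (W v) ^ 2 / (1 + 2 * X (W v)) ^ m := by
      simp only [f, hev₀]
      ring
    rw [he]
    refine (norm_add_le _ _).trans_lt ?_
    rw [norm_mul, Complex.norm_ofNat]
    linarith
  obtain ⟨v, hv, hfv⟩ := DiffContOnCl.exists_zero_of_norm_center_lt (f := f) (z₀ := v₀)
    (r := 1 / 2) (δ := ‖x₀‖ / 4) (by norm_num)
    (DifferentiableOn.diffContOnCl (by rwa [closure_ball _ (by norm_num)])) (fun v hv => by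
      have h3 := norm_exp_sub_exp_ge (v := v) (v₀ := v₀) (by rwa [← dist_eq_norm])
      have h4 := hclose v (Metric.sphere_subset_closedBall hv)
      have h5 := norm_sub_norm_le (Complex.exp v - Complex.exp v₀)
        (Complex.exp v - Complex.exp v₀ - f v)
      rw [norm_sub_rev] at h4
      rw [sub_sub_cancel] at h5
      have h6 : ‖Complex.exp v₀‖ = 2 * ‖x₀‖ := by rw [hev₀, norm_neg, norm_mul]; simp
      rw [h6] at h3
      linarith) (by
      simpa using hclose v₀ (Metric.mem_closedBall_self (by norm_num)))
  obtain ⟨-, hb1, -⟩ := hball (hWdist v hv)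
  refine ⟨X (W v), hb1.trans_le (min_le_left _ _), ?_⟩
  have hpow : (1 + 2 * X (W v)) ^ m ≠ 0 := pow_ne_zero _ (hne v hv)
  rw [hXeq, mul_pow, hWexp]
  simp only [f] at hfv
  field_simp at hfv
  linear_combination hfv

/-- The curve `|1 + x|² = |1 + 2x|` contains a point with real part `(√2 - 1) / 2`; the square of
its imaginary part is `(1 + 2√2) / 4`. -/
theorem exists_mem_curve_re_eq :
    ∃ x₀ : ℂ, x₀.re = (Real.sqrt 2 - 1) / 2 ∧ ‖(1 + x₀) ^ 2‖ = ‖1 + 2 * x₀‖ ∧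
      1 < ‖1 + 2 * x₀‖ := by
  have hs : Real.sqrt 2 ^ 2 = 2 := Real.sq_sqrt (by norm_num)
  have hs1 : 1 < Real.sqrt 2 := Real.lt_sqrt_of_sq_lt (by norm_num)
  set s := Real.sqrt 2
  set b := Real.sqrt ((1 + 2 * s) / 4)
  have hb : b ^ 2 = (1 + 2 * s) / 4 := Real.sq_sqrt (by positivity)
  refine ⟨⟨(s - 1) / 2, b⟩, rfl, ?_, ?_⟩
  · rw [norm_pow, Complex.sq_norm, ← sq_eq_sq₀ (Complex.normSq_nonneg _) (norm_nonneg _),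
      Complex.sq_norm, Complex.normSq_apply, Complex.normSq_apply]
    simp
    have : b * b = (1 + 2 * s) / 4 := by rw [← sq, hb]
    rw [this, show 2 * b * (2 * b) = 4 * (b * b) by ring, this]
    ring_nf
    nlinarith
  · refine lt_of_lt_of_le ?_ (Complex.re_le_norm _)
    simp
    linarith

/-! ### Zeros with positive real part -/

theorem mainTheorem4 :
    (∃ n₀ : ℕ, ∀ n : ℕ, n₀ ≤ n →
      ∃ z : ℂ, Polynomial.aeval z (starLexK2 n).acyclicPoly = 0 ∧ 0 < z.re) ∧
    (∀ ε : ℝ, 0 < ε → ∃ n₀ : ℕ, ∀ n : ℕ, n₀ ≤ n →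
      ∃ z : ℂ, Polynomial.aeval z (starLexK2 n).acyclicPoly = 0 ∧ 0 < z.re ∧
        |z.re - (Real.sqrt 2 - 1) / 2| < ε) := by
  have hs1 : 1 < Real.sqrt 2 := Real.lt_sqrt_of_sq_lt (by norm_num)
  have main : ∀ ε : ℝ, 0 < ε → ∃ n₀ : ℕ, ∀ n : ℕ, n₀ ≤ n →
      ∃ z : ℂ, Polynomial.aeval z (starLexK2 n).acyclicPoly = 0 ∧ 0 < z.re ∧
        |z.re - (Real.sqrt 2 - 1) / 2| < ε := by
    intro ε hε
    obtain ⟨x₀, hre, hcurve, hgt⟩ := exists_mem_curve_re_eq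
    have hx₀ : x₀ ≠ 0 := by
      rintro rfl
      simp at hgt
    obtain ⟨m₀, hm₀⟩ := eventually_atTop.1 (eventually_exists_zero_near hx₀ hcurve hgt
      (lt_min hε (show 0 < (Real.sqrt 2 - 1) / 2 by linarith)))
    refine ⟨m₀ + 1, fun n hn => ?_⟩
    obtain ⟨z, hz, hroot⟩ := hm₀ (n - 1) (by omega)
    have hz' : |z.re - (Real.sqrt 2 - 1) / 2| < min ε ((Real.sqrt 2 - 1) / 2) := by
      rw [← hre, ← Complex.sub_re]
      rw [← hre] at hz
      exact (Complex.abs_re_le_norm _).trans_lt hz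
    refine ⟨z, by rw [aeval_acyclicPoly_starLexK2, hroot], ?_, hz'.trans_le (min_le_left _ _)⟩
    have := (abs_lt.1 (hz'.trans_le (min_le_right _ _))).1
    linarith
  obtain ⟨n₀, hn₀⟩ := main 1 one_pos
  exact ⟨⟨n₀, fun n hn => let ⟨z, h, hpos, _⟩ := hn₀ n hn; ⟨z, h, hpos⟩⟩, main⟩
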